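/- A gauged measure space (gm-space) is a triple $\mathbb X=(X,g,\xi)$ of a Polish space $X$, a Borel probability measure $\xi$ on $X$, and a gauge $g\in L^2_{\mathrm{sym}}(X\times X,\xi\otimes\xi)$, i.e. a symmetric real-valued function that is square-integrable with respect to $\xi\otimes\xi$. For gm-spaces $\mathbb X=(X,g,\xi)$ and $\mathbb Y=(Y,h,\upsilon)$, let $\Pi(\mathbb X,\mathbb Y)$ be the set of Borel probability measures on $X\times Y$ with marginals $\xi$ and $\upsilon$, and let $$\mathrm{GW}(\mathbb X,\mathbb Y)=\inf_{\pi\in\Pi(\mathbb X,\mathbb Y)}\Bigl(\iint_{(X\times Y)^2}|g(x,x')-h(y,y')|^2\,\mathrm d\pi(x,y)\,\mathrm d\pi(x',y')\Bigr)^{1/2}.$$ The spaces $\mathbb X$ and $\mathbb Y$ are called homomorphic if $\mathrm{GW}(\mathbb X,\mathbb Y)=0$; this is an equivalence relation, $\llbracket\mathbb X\rrbracket$ denotes the class of $\mathbb X$, $\mathfrak{GM}$ denotes the space of all classes, and $\mathrm{GW}$ is well defined on $\mathfrak{GM}$. **Theorem 5.1.** Let $\mathbb X_i=(X_i,g_i,\xi_i)$,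 $i=1,\dots,N$, be gm-spaces, let $\mathfrak X_i=\llbracket\mathbb X_i\rrbracket$, and let $\rho\in\Delta_{N-1}=\{\rho\in[0,1]^N:\sum_{i=1}^N\rho_i=1\}$. Let $X_\times=X_1\times\dots\times X_N$, let $\Pi(\mathbb X_1,\dots,\mathbb X_N)$ be the set of Borel probability measures on $X_\times$ with marginals $\xi_1,\dots,\xi_N$, and let $\Pi_{\mathrm o}^\rho(\mathbb X_1,\dots,\mathbb X_N)$ be the set of all $\pi\in\Pi(\mathbb X_1,\dots,\mathbb X_N)$ that minimize $$\iint_{X_\times^2}\frac12\sum_{i,j=1}^N\rho_i\rho_j\,|g_i(x_i,x_i')-g_j(x_j,x_j')|^2\,\mathrm d\pi(x_\times)\,\mathrm d\pi(x_\times')$$ over $\Pi(\mathbb X_1,\dots,\mathbb X_N)$. Then there exists a (free-support) GW barycenter, i.e. some $\mathfrak Y\in\mathfrak{GM}$ that minimizes $$\mathfrak Y\mapsto\sum_{i=1}^N\rho_i\,\mathrm{GW}(\mathfrak X_i,\mathfrak Y)^2$$ over $\mathfrak{GM}$. Moreover, the set of all such minimizers is exactly $$\Bigl\{\bigl\llbracket\bigl(X_\times,\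 \textstyle\sum_{i=1}^N\rho_i g_i,\ \hat\pi\bigr)\bigr\rrbracket:\hat\pi\in\Pi_{\mathrm o}^\rho(\mathbb X_1,\dots,\mathbb X_N)\Bigr\},$$ where $\sum_{i=1}^N\rho_i g_i$ denotes the gauge $(x_\times,x_\times')\mapsto\sum_{i=1}^N\rho_i\,g_i(x_i,x_i')$ on $X_\times$. -/

import Mathlib

open MeasureTheory ProbabilityTheory Set
open scoped ENNReal

universe u

noncomputable section

/-- A gauged measure space `(X, g, ξ)`: a Polish space `X` with its Borel σ-algebra, a Borel
probability measure `ξ`, and a gauge `g ∈ L²_sym(X × X, ξ ⊗ ξ)`.  The gauge is given by a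
representative; as usual for `L²`, symmetry is required almost everywhere. -/
structure GMSpace : Type (u + 1) where
  carrier : Type u
  [topology : TopologicalSpace carrier]
  [polish : PolishSpace carrier]
  [borel : MeasurableSpace carrier]
  [isBorel : BorelSpace carrier]
  measure : Measure carrier
  [isProb : IsProbabilityMeasure measure]
  gauge : carrier × carrier → ℝ
  gauge_memLp : MemLp gauge 2 (measure.prod measure)
  gauge_symm : ∀ᵐ p ∂(measure.prod measure), gauge p.swap = gauge p

namespace GMSpace

attribute [instance] topology polish borel isBorel isProb

instance instNonempty (X : GMSpace.{u}) : Nonempty X.carrier :=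
  nonempty_of_isProbabilityMeasure X.measure

/-- Transport plans between two gm-spaces. -/
def plans (X Y : GMSpace.{u}) : Set (ProbabilityMeasure (X.carrier × Y.carrier)) :=
  {π | (π : Measure (X.carrier × Y.carrier)).map Prod.fst = X.measure ∧
    (π : Measure (X.carrier × Y.carrier)).map Prod.snd = Y.measure}

/-- The difference `((x, y), (x', y')) ↦ g (x, x') - h (y, y')` of two gauges. -/
def gaugeDiff (X Y : GMSpace.{u}) (p : (X.carrier × Y.carrier) × (X.carrier × Y.carrier)) : ℝ :=
  X.gauge (p.1.1, p.2.1) - Y.gauge (p.1.2, p.2.2)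

/-- The GW functional: the `L²(π ⊗ π)`-norm of the difference of the gauges. -/
def gwFunctional (X Y : GMSpace.{u}) (π : ProbabilityMeasure (X.carrier × Y.carrier)) : ℝ≥0∞ :=
  eLpNorm (gaugeDiff X Y) 2
    ((π : Measure (X.carrier × Y.carrier)).prod (π : Measure (X.carrier × Y.carrier)))

/-- The GW distance between two gm-spaces, valued in `[0, ∞]` (the gauges being
square-integrable, it is in fact always finite). -/
def gw (X Y : GMSpace.{u}) : ℝ≥0∞ :=
  ⨅ π ∈ plans X Y, gwFunctional X Y π

/-! ### `GW` is a pseudometric -/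

lemma gw_self (X : GMSpace.{u}) : gw X X = 0 := by
  have hm : Measurable (fun x : X.carrier => (x, x)) := by fun_prop
  let π : ProbabilityMeasure (X.carrier × X.carrier) :=
    ⟨X.measure.map (fun x => (x, x)), Measure.isProbabilityMeasure_map hm.aemeasurable⟩
  have hπ : (π : Measure (X.carrier × X.carrier)) = X.measure.map (fun x => (x, x)) := rfl
  have hmem : π ∈ plans X X := by
    constructor
    · rw [hπ, Measure.map_map measurable_fst hm]
      exact Measure.map_id
    · rw [hπ, Measure.map_map measurable_snd hm]
      exact Measure.map_id
  refine le_antisymm ((iInf₂_le π hmem).trans (le_of_eq ?_)) bot_le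
  have hmp : MeasurePreserving (fun x : X.carrier => (x, x)) X.measure
      (π : Measure (X.carrier × X.carrier)) := ⟨hm, rfl⟩
  have hp1 : MeasurePreserving (Prod.fst : X.carrier × X.carrier → _)
      (π : Measure (X.carrier × X.carrier)) X.measure := ⟨measurable_fst, hmem.1⟩
  have hp2 : MeasurePreserving (Prod.snd : X.carrier × X.carrier → _)
      (π : Measure (X.carrier × X.carrier)) X.measure := ⟨measurable_snd, hmem.2⟩
  have hd : AEStronglyMeasurable (gaugeDiff X X)
      ((π : Measure (X.carrier × X.carrier)).prod (π : Measure (X.carrier × X.carrier))) :=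
    (X.gauge_memLp.1.comp_measurePreserving (hp1.prod hp1)).sub
      (X.gauge_memLp.1.comp_measurePreserving (hp2.prod hp2))
  rw [gwFunctional, ← eLpNorm_comp_measurePreserving hd (hmp.prod hmp)]
  have h0 : gaugeDiff X X ∘ Prod.map (fun x : X.carrier => (x, x)) (fun x => (x, x)) = 0 := by
    funext p
    simp [gaugeDiff]
  rw [h0]
  simp

lemma gaugeDiff_aestronglyMeasurable (X Y : GMSpace.{u})
    {π : ProbabilityMeasure (X.carrier × Y.carrier)} (hπ : π ∈ plans X Y) :
    AEStronglyMeasurable (gaugeDiff X Y)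
      ((π : Measure (X.carrier × Y.carrier)).prod (π : Measure (X.carrier × Y.carrier))) := by
  have hp1 : MeasurePreserving (Prod.fst : X.carrier × Y.carrier → _)
      (π : Measure (X.carrier × Y.carrier)) X.measure := ⟨measurable_fst, hπ.1⟩
  have hp2 : MeasurePreserving (Prod.snd : X.carrier × Y.carrier → _)
      (π : Measure (X.carrier × Y.carrier)) Y.measure := ⟨measurable_snd, hπ.2⟩
  exact (X.gauge_memLp.1.comp_measurePreserving (hp1.prod hp1)).sub
      (Y.gauge_memLp.1.comp_measurePreserving (hp2.prod hp2))

lemma gw_comm_le (X Y : GMSpace.{u}) : gw Y X ≤ gw X Y := by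
  refine le_iInf₂ fun π hπ => ?_
  let σ : ProbabilityMeasure (Y.carrier × X.carrier) :=
    ⟨(π : Measure (X.carrier × Y.carrier)).map Prod.swap,
      Measure.isProbabilityMeasure_map measurable_swap.aemeasurable⟩
  have hmp : MeasurePreserving (Prod.swap : X.carrier × Y.carrier → _)
      (π : Measure (X.carrier × Y.carrier)) (σ : Measure (Y.carrier × X.carrier)) :=
    ⟨measurable_swap, rfl⟩
  have hσ : σ ∈ plans Y X := by
    constructor
    · rw [← hmp.map_eq, Measure.map_map measurable_fst measurable_swap]
      exact hπ.2
    · rw [← hmp.map_eq, Measure.map_map measurable_snd measurable_swap]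
      exact hπ.1
  refine (iInf₂_le σ hσ).trans (le_of_eq ?_)
  rw [gwFunctional, gwFunctional,
    ← eLpNorm_comp_measurePreserving (gaugeDiff_aestronglyMeasurable Y X hσ) (hmp.prod hmp),
    ← eLpNorm_neg]
  congr 1
  funext p
  simp [gaugeDiff]

lemma gw_comm (X Y : GMSpace.{u}) : gw X Y = gw Y X :=
  le_antisymm (gw_comm_le Y X) (gw_comm_le X Y)

/-- Gluing of two transport plans along their common marginal. -/
lemma exists_gluing (X Y Z : GMSpace.{u})
    {π₁ : ProbabilityMeasure (X.carrier × Y.carrier)} (h₁ : π₁ ∈ plans X Y)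
    {π₂ : ProbabilityMeasure (Y.carrier × Z.carrier)} (h₂ : π₂ ∈ plans Y Z) :
    ∃ γ : ProbabilityMeasure ((X.carrier × Y.carrier) × Z.carrier),
      MeasurePreserving Prod.fst (γ : Measure ((X.carrier × Y.carrier) × Z.carrier))
        (π₁ : Measure (X.carrier × Y.carrier)) ∧
      MeasurePreserving (fun p : (X.carrier × Y.carrier) × Z.carrier => (p.1.2, p.2))
        (γ : Measure ((X.carrier × Y.carrier) × Z.carrier))
        (π₂ : Measure (Y.carrier × Z.carrier)) := by
  let κ : Kernel Y.carrier Z.carrier := (π₂ : Measure (Y.carrier × Z.carrier)).condKernel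
  let η : Kernel (X.carrier × Y.carrier) Z.carrier := κ.comap Prod.snd measurable_snd
  refine ⟨⟨(π₁ : Measure (X.carrier × Y.carrier)) ⊗ₘ η, inferInstance⟩, ⟨measurable_fst, ?_⟩,
    ⟨by fun_prop, ?_⟩⟩
  · exact Measure.fst_compProd _ η
  · have hd : (π₂ : Measure (Y.carrier × Z.carrier)).fst ⊗ₘ κ = π₂ :=
      (π₂ : Measure (Y.carrier × Z.carrier)).disintegrate κ
    have hfst : (π₂ : Measure (Y.carrier × Z.carrier)).fst
        = (π₁ : Measure (X.carrier × Y.carrier)).map Prod.snd := h₂.1.trans h₁.2.symm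
    rw [hfst] at hd
    refine Eq.trans ?_ hd
    ext s hs
    have hm : Measurable (fun p : (X.carrier × Y.carrier) × Z.carrier => (p.1.2, p.2)) := by
      fun_prop
    change (((π₁ : Measure (X.carrier × Y.carrier)) ⊗ₘ η).map _) s = _
    rw [Measure.map_apply hm hs, Measure.compProd_apply (hm hs), Measure.compProd_apply hs,
      lintegral_map (Kernel.measurable_kernel_prodMk_left hs) measurable_snd]
    rfl

lemma gw_triangle (X Y Z : GMSpace.{u}) : gw X Z ≤ gw X Y + gw Y Z := by
  have key : ∀ π₁ ∈ plans X Y, ∀ π₂ ∈ plans Y Z,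
      gw X Z ≤ gwFunctional X Y π₁ + gwFunctional Y Z π₂ := by
    intro π₁ h₁ π₂ h₂
    obtain ⟨γ, hγ₁, hγ₂⟩ := exists_gluing X Y Z h₁ h₂
    have hm : Measurable (fun p : (X.carrier × Y.carrier) × Z.carrier => (p.1.1, p.2)) := by
      fun_prop
    let σ : ProbabilityMeasure (X.carrier × Z.carrier) :=
      ⟨(γ : Measure ((X.carrier × Y.carrier) × Z.carrier)).map (fun p => (p.1.1, p.2)),
        Measure.isProbabilityMeasure_map hm.aemeasurable⟩
    have hγ₃ : MeasurePreserving
        (fun p : (X.carrier × Y.carrier) × Z.carrier => (p.1.1, p.2))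
        (γ : Measure ((X.carrier × Y.carrier) × Z.carrier))
        (σ : Measure (X.carrier × Z.carrier)) := ⟨hm, rfl⟩
    have hσ : σ ∈ plans X Z := by
      constructor
      · rw [← hγ₃.map_eq, Measure.map_map measurable_fst hm, ← h₁.1, ← hγ₁.map_eq,
          Measure.map_map measurable_fst measurable_fst]
        rfl
      · rw [← hγ₃.map_eq, Measure.map_map measurable_snd hm, ← h₂.2, ← hγ₂.map_eq,
          Measure.map_map measurable_snd hγ₂.measurable]
        rfl
    refine (iInf₂_le σ hσ).trans ?_
    have a₁ := gaugeDiff_aestronglyMeasurable X Y h₁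
    have a₂ := gaugeDiff_aestronglyMeasurable Y Z h₂
    have a₃ := gaugeDiff_aestronglyMeasurable X Z hσ
    rw [gwFunctional, gwFunctional, gwFunctional,
      ← eLpNorm_comp_measurePreserving a₁ (hγ₁.prod hγ₁),
      ← eLpNorm_comp_measurePreserving a₂ (hγ₂.prod hγ₂),
      ← eLpNorm_comp_measurePreserving a₃ (hγ₃.prod hγ₃)]
    refine le_trans (le_of_eq ?_) (eLpNorm_add_le
      (a₁.comp_measurePreserving (hγ₁.prod hγ₁)) (a₂.comp_measurePreserving (hγ₂.prod hγ₂))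
      (by norm_num))
    congr 1
    funext p
    simp [gaugeDiff]
  unfold gw
  simp_rw [ENNReal.iInf_add, ENNReal.add_iInf]
  exact le_iInf fun π₁ => le_iInf fun h₁ => le_iInf fun π₂ => le_iInf fun h₂ => key π₁ h₁ π₂ h₂

/-- Two gm-spaces are homomorphic if their GW distance vanishes. -/
instance homomorphic : Setoid GMSpace.{u} where
  r X Y := gw X Y = 0
  iseqv :=
    { refl := gw_self
      symm := fun {X Y} h => by rw [gw_comm]; exact h
      trans := fun {X Y Z} h₁ h₂ => by
        have h := gw_triangle X Y Z
        rw [h₁, h₂, add_zero] at h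
        exact le_antisymm h bot_le }

end GMSpace

/-- The space of homomorphic classes of gm-spaces. -/
def GM : Type (u + 1) := Quotient GMSpace.homomorphic.{u}

namespace GM

/-- The homomorphic class of a gm-space. -/
def mk (X : GMSpace.{u}) : GM.{u} := Quotient.mk GMSpace.homomorphic X

/-- The GW distance between homomorphic classes. -/
def gw : GM.{u} → GM.{u} → ℝ≥0∞ :=
  Quotient.lift₂ GMSpace.gw (by
    intro X Y X' Y' (hX : GMSpace.gw X X' = 0) (hY : GMSpace.gw Y Y' = 0)
    have hX' : GMSpace.gw X' X = 0 := by rw [GMSpace.gw_comm]; exact hX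
    have hY' : GMSpace.gw Y' Y = 0 := by rw [GMSpace.gw_comm]; exact hY
    refine le_antisymm ?_ ?_
    · calc GMSpace.gw X Y ≤ GMSpace.gw X X' + GMSpace.gw X' Y := GMSpace.gw_triangle _ _ _
        _ ≤ GMSpace.gw X X' + (GMSpace.gw X' Y' + GMSpace.gw Y' Y) := by
          gcongr; exact GMSpace.gw_triangle _ _ _
        _ = GMSpace.gw X' Y' := by rw [hX, hY', zero_add, add_zero]
    · calc GMSpace.gw X' Y' ≤ GMSpace.gw X' X + GMSpace.gw X Y' := GMSpace.gw_triangle _ _ _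
        _ ≤ GMSpace.gw X' X + (GMSpace.gw X Y + GMSpace.gw Y Y') := by
          gcongr; exact GMSpace.gw_triangle _ _ _
        _ = GMSpace.gw X Y := by rw [hX', hY, zero_add, add_zero])

variable {N : ℕ}

/-- The GW barycenter loss `𝔜 ↦ ∑ i, ρ i * GW (𝔛 i, 𝔜) ^ 2`. -/
def barycenterLoss (ρ : Fin N → ℝ) (𝔛 : Fin N → GM.{u}) (𝔜 : GM.{u}) : ℝ≥0∞ :=
  ∑ i, ENNReal.ofReal (ρ i) * gw (𝔛 i) 𝔜 ^ 2

/-- The optimal value of the free-support GW barycenter problem. -/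
def gwb (ρ : Fin N → ℝ) (𝔛 : Fin N → GM.{u}) : ℝ≥0∞ :=
  ⨅ 𝔜 : GM.{u}, barycenterLoss ρ 𝔛 𝔜

/-- The free-support GW barycenters: the minimizers of the loss over the whole space `GM`. -/
def barycenters (ρ : Fin N → ℝ) (𝔛 : Fin N → GM.{u}) : Set GM.{u} :=
  {𝔜 | barycenterLoss ρ 𝔛 𝔜 = gwb ρ 𝔛}

end GM

namespace GMSpace

variable {N : ℕ}

/-- Multi-marginal transport plans. -/
def multiPlans (X : Fin N → GMSpace.{u}) : Set (ProbabilityMeasure (∀ i, (X i).carrier)) :=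
  {π | ∀ i, (π : Measure (∀ i, (X i).carrier)).map (fun x => x i) = (X i).measure}

/-- The multi-marginal GW functional; its integrand is nonnegative for nonnegative weights. -/
def mgwFunctional (ρ : Fin N → ℝ) (X : Fin N → GMSpace.{u})
    (π : ProbabilityMeasure (∀ i, (X i).carrier)) : ℝ≥0∞ :=
  ∫⁻ p, ENNReal.ofReal ((1 / 2) * ∑ i, ∑ j, ρ i * ρ j *
      |(X i).gauge (p.1 i, p.2 i) - (X j).gauge (p.1 j, p.2 j)| ^ 2)
    ∂((π : Measure (∀ i, (X i).carrier)).prod (π : Measure (∀ i, (X i).carrier)))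

/-- The optimal value of the multi-marginal GW problem. -/
def mgw (ρ : Fin N → ℝ) (X : Fin N → GMSpace.{u}) : ℝ≥0∞ :=
  ⨅ π ∈ multiPlans X, mgwFunctional ρ X π

/-- The optimal multi-marginal GW plans. -/
def optimalMultiPlans (ρ : Fin N → ℝ) (X : Fin N → GMSpace.{u}) :
    Set (ProbabilityMeasure (∀ i, (X i).carrier)) :=
  {π | π ∈ multiPlans X ∧ mgwFunctional ρ X π = mgw ρ X}

/-- The gm-space `(X_×, ∑ i, ρ i * g i, π)` on the product of the domains, for a multi-marginal
plan `π`. -/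
def weightedProduct (ρ : Fin N → ℝ) (X : Fin N → GMSpace.{u})
    (π : ProbabilityMeasure (∀ i, (X i).carrier)) (hπ : π ∈ multiPlans X) : GMSpace.{u} where
  carrier := ∀ i, (X i).carrier
  measure := π
  gauge p := ∑ i, ρ i * (X i).gauge (p.1 i, p.2 i)
  gauge_memLp := by
    refine memLp_finsetSum _ fun i _ => MemLp.const_mul ?_ (ρ i)
    have hi : MeasurePreserving (fun x : ∀ i, (X i).carrier => x i)
        (π : Measure (∀ i, (X i).carrier)) (X i).measure := ⟨measurable_pi_apply i, hπ i⟩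
    exact (X i).gauge_memLp.comp_measurePreserving (hi.prod hi)
  gauge_symm := by
    have h : ∀ i, ∀ᵐ p ∂((π : Measure (∀ i, (X i).carrier)).prod
        (π : Measure (∀ i, (X i).carrier))),
        (X i).gauge (p.2 i, p.1 i) = (X i).gauge (p.1 i, p.2 i) := by
      intro i
      have hi : MeasurePreserving (fun x : ∀ i, (X i).carrier => x i)
          (π : Measure (∀ i, (X i).carrier)) (X i).measure := ⟨measurable_pi_apply i, hπ i⟩
      exact (hi.prod hi).quasiMeasurePreserving.ae (X i).gauge_symm
    filter_upwards [ae_all_iff.2 h] with p hp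
    exact Finset.sum_congr rfl fun i _ => by rw [Prod.fst_swap, Prod.snd_swap, hp i]

end GMSpace

end

open Filter Topology
open scoped NNReal BoundedContinuousFunction

/-! The theorem rests on the Hilbert-space variance identity: for weights summing to one, the
weighted mean square distance of `H` to the `G i` is half the weighted sum of the squared pairwise
distances plus the squared distance of `H` to the mean (`sum_mul_eLpNorm_sq_sub_eq`). Integrated
against a coupling, its first term is the multi-marginal cost, and its second term compares a
candidate gauge with the averaged gauge.

For a plan `π`, taking `H` to be the mean removes the second term, so the loss of the weighted
product is at most the cost of `π` (`barycenterLoss_weightedProduct_le`). For an arbitrary `Y`,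
gluing optimal plans between `Y` and the `X i` along `Y` yields some `π` whose cost, plus the
squared GW distance from `Y` to the weighted product of `π`, is at most the loss of `Y`
(`exists_mgwFunctional_add_gw_sq_le`). Hence the two optimal values agree, and optimal plans give
barycenters. For a barycenter `Y` the glued plan must be optimal and the distance must vanish.

Optimal plans exist by compactness of the sets of plans and lower semicontinuity of the costs. The
gauges are merely square-integrable, so the latter needs the fixed marginals
(`lowerSemicontinuousOn_eLpNorm_sub`). -/

section MeasureTheoryLemmas

/-! ### Tightness and closedness of marginal constraints -/

/-- A set of measures on a finite product is tight if all its marginals are tight. -/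
lemma isTightMeasureSet_pi {ι : Type*} [Finite ι] {A : ι → Type*} [∀ i, TopologicalSpace (A i)]
    [∀ i, MeasurableSpace (A i)] {S : Set (Measure (∀ i, A i))}
    (hS : ∀ i, IsTightMeasureSet ((fun μ => μ.map (fun x => x i)) '' S)) :
    IsTightMeasureSet S := by
  have := Fintype.ofFinite ι
  simp only [isTightMeasureSet_iff_exists_isCompact_measure_compl_le] at hS ⊢
  intro ε hε
  obtain ⟨δ, hδ, hsum⟩ := ENNReal.exists_pos_sum_of_countable hε.ne' ι
  choose K hK hKS using fun i => hS i (δ i) (by exact_mod_cast hδ i)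
  refine ⟨Set.pi univ K, isCompact_univ_pi hK, fun μ hμ => ?_⟩
  have hsub : (Set.pi univ K)ᶜ ⊆ ⋃ i, (fun x : ∀ i, A i => x i) ⁻¹' (K i)ᶜ := by
    intro x hx
    simpa [Set.mem_pi] using hx
  calc μ (Set.pi univ K)ᶜ ≤ ∑' i, μ ((fun x : ∀ i, A i => x i) ⁻¹' (K i)ᶜ) :=
        (measure_mono hsub).trans (measure_iUnion_le _)
    _ ≤ ∑' i, (δ i : ℝ≥0∞) := by
        gcongr with i
        exact (Measure.le_map_apply (measurable_pi_apply i).aemeasurable _).trans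
          (hKS i _ (mem_image_of_mem _ hμ))
    _ ≤ ε := hsum.le

/-- A single finite Borel measure on a Polish space is tight. This applies to the set of marginals
of a family of plans, which contains at most one measure. -/
lemma isTightMeasureSet_of_subset_singleton {A : Type*} [TopologicalSpace A] [PolishSpace A]
    [MeasurableSpace A] [BorelSpace A] {S : Set (Measure A)} {μ : Measure A} [IsFiniteMeasure μ]
    (hS : ∀ ν ∈ S, ν = μ) : IsTightMeasureSet S :=
  isTightMeasureSet_singleton.subset (T := {μ}) hS

/-- Fixing a marginal along a continuous map is a closed condition on probability measures. -/
lemma isClosed_setOf_map_eq {E A : Type*} [TopologicalSpace E] [MeasurableSpace E] [BorelSpace E]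
    [TopologicalSpace A] [PolishSpace A] [MeasurableSpace A] [BorelSpace A]
    {f : E → A} (hf : Continuous f) (ξ : Measure A) [IsProbabilityMeasure ξ] :
    IsClosed {π : ProbabilityMeasure E | (π : Measure E).map f = ξ} := by
  have h : {π : ProbabilityMeasure E | (π : Measure E).map f = ξ} =
      (fun π : ProbabilityMeasure E => π.map hf.measurable.aemeasurable) ⁻¹'
        {(⟨ξ, inferInstance⟩ : ProbabilityMeasure A)} := by
    ext π
    exact (Subtype.ext_iff (a1 := π.map hf.measurable.aemeasurable)
      (a2 := (⟨ξ, inferInstance⟩ : ProbabilityMeasure A))).symm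
  rw [h]
  exact isClosed_singleton.preimage (ProbabilityMeasure.continuous_map hf)

/-! ### Lower semicontinuity of `L²` costs under fixed marginals -/

lemma eLpNorm_two_sq {α : Type*} [MeasurableSpace α] (μ : Measure α) (f : α → ℝ) :
    eLpNorm f 2 μ ^ 2 = ∫⁻ a, ENNReal.ofReal (f a ^ 2) ∂μ := by
  have h := eLpNorm_nnreal_pow_eq_lintegral (μ := μ) (f := f) (p := 2) (by norm_num)
  simp only [ENNReal.coe_ofNat, NNReal.coe_ofNat, ENNReal.rpow_ofNat] at h
  rw [h]
  refine lintegral_congr fun a => ?_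
  rw [← ofReal_norm, ← ENNReal.ofReal_pow (norm_nonneg _), Real.norm_eq_abs, sq_abs]

/-- The `L²(π ⊗ π)`-norm of a bounded continuous function depends continuously on `π`. -/
lemma continuous_eLpNorm_prod_self {E : Type*} [TopologicalSpace E] [PolishSpace E]
    [MeasurableSpace E] [BorelSpace E] (f : E × E →ᵇ ℝ) :
    Continuous fun π : ProbabilityMeasure E =>
      eLpNorm f 2 ((π : Measure E).prod (π : Measure E)) := by
  have hsq : Continuous fun π : ProbabilityMeasure E =>
      eLpNorm f 2 ((π : Measure E).prod (π : Measure E)) ^ 2 := by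
    -- Weak convergence passes to `π ⊗ π`, and `f * f` is nonnegative, so taking `nnrealPart` loses
    -- nothing.
    have hc := (ProbabilityMeasure.continuous_lintegral_boundedContinuousFunction
      (f * f).nnrealPart).comp (ProbabilityMeasure.continuous_prod.comp
        (continuous_id.prodMk (continuous_id (X := ProbabilityMeasure E))))
    refine hc.congr fun π => ?_
    rw [eLpNorm_two_sq]
    refine lintegral_congr fun p => ?_
    simp [BoundedContinuousFunction.nnrealPart_coeFn_eq, ENNReal.ofReal, sq]
  have := (ENNReal.continuous_rpow_const (y := (1 / 2 : ℝ))).comp hsq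
  refine this.congr fun π => ?_
  simp only [Function.comp_apply]
  rw [← ENNReal.rpow_natCast, ← ENNReal.rpow_mul]
  norm_num

/-- For square-integrable gauges `g` and `h`, the `L²(π ⊗ π)`-norm of the difference of their
pullbacks is lower semicontinuous in `π` as long as the marginals of `π` are fixed. -/
lemma lowerSemicontinuousOn_eLpNorm_sub {E A B : Type*}
    [TopologicalSpace E] [PolishSpace E] [MeasurableSpace E] [BorelSpace E]
    [TopologicalSpace A] [PolishSpace A] [MeasurableSpace A] [BorelSpace A]
    [TopologicalSpace B] [PolishSpace B] [MeasurableSpace B] [BorelSpace B]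
    {a : E → A} {b : E → B} (ha : Continuous a) (hb : Continuous b)
    {ξ : Measure A} {υ : Measure B} [IsProbabilityMeasure ξ] [IsProbabilityMeasure υ]
    {g : A × A → ℝ} {h : B × B → ℝ}
    (hg : MemLp g 2 (ξ.prod ξ)) (hh : MemLp h 2 (υ.prod υ))
    {S : Set (ProbabilityMeasure E)}
    (hSa : ∀ π ∈ S, (π : Measure E).map a = ξ) (hSb : ∀ π ∈ S, (π : Measure E).map b = υ) :
    LowerSemicontinuousOn (fun π : ProbabilityMeasure E =>
      eLpNorm (fun p : E × E => g (a p.1, a p.2) - h (b p.1, b p.2)) 2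
        ((π : Measure E).prod (π : Measure E))) S := by
  have hca : Continuous (Prod.map a a) := ha.prodMap ha
  have hcb : Continuous (Prod.map b b) := hb.prodMap hb
  let F (π : ProbabilityMeasure E) : ℝ≥0∞ :=
    eLpNorm (fun p : E × E => g (a p.1, a p.2) - h (b p.1, b p.2)) 2
      ((π : Measure E).prod (π : Measure E))
  let D (q : (A × A →ᵇ ℝ) × (B × B →ᵇ ℝ)) : E × E →ᵇ ℝ :=
    q.1.compContinuous ⟨_, hca⟩ - q.2.compContinuous ⟨_, hcb⟩
  let e (q : (A × A →ᵇ ℝ) × (B × B →ᵇ ℝ)) : ℝ≥0∞ :=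
    eLpNorm (g - ⇑q.1) 2 (ξ.prod ξ) + eLpNorm (h - ⇑q.2) 2 (υ.prod υ)
  -- Replacing the gauges by bounded continuous functions `q` costs at most `e q`, which depends
  -- only on the marginals and not on `π`. Each term is therefore continuous in `π` and a lower
  -- bound for `F` on `S`; density in `L²` makes the supremum equal to `F` there.
  let L (π : ProbabilityMeasure E) : ℝ≥0∞ :=
    ⨆ q, eLpNorm (D q) 2 ((π : Measure E).prod (π : Measure E)) - e q
  have hL : LowerSemicontinuousOn L S := by
    refine lowerSemicontinuousOn_iSup fun q => Continuous.continuousOn ?_ |>.lowerSemicontinuousOn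
    exact (ENNReal.continuous_sub_right _).comp (continuous_eLpNorm_prod_self (D q))
  have hclose : ∀ π ∈ S, ∀ q, eLpNorm ((fun p : E × E => g (a p.1, a p.2) - h (b p.1, b p.2)) - ⇑(D q))
      2 ((π : Measure E).prod (π : Measure E)) ≤ e q := by
    intro π hπ q
    have mpa : MeasurePreserving a (π : Measure E) ξ := ⟨ha.measurable, hSa π hπ⟩
    have mpb : MeasurePreserving b (π : Measure E) υ := ⟨hb.measurable, hSb π hπ⟩
    have sg : AEStronglyMeasurable (g - ⇑q.1) (ξ.prod ξ) :=
      hg.1.sub q.1.continuous.aestronglyMeasurable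
    have sh : AEStronglyMeasurable (h - ⇑q.2) (υ.prod υ) :=
      hh.1.sub q.2.continuous.aestronglyMeasurable
    simp only [e]
    rw [← eLpNorm_comp_measurePreserving sg (mpa.prod mpa),
      ← eLpNorm_comp_measurePreserving sh (mpb.prod mpb)]
    refine le_trans (le_of_eq ?_) (eLpNorm_sub_le (sg.comp_measurePreserving (mpa.prod mpa))
      (sh.comp_measurePreserving (mpb.prod mpb)) (by norm_num))
    congr 1
    funext p
    simp [D, Prod.map]
    ring
  have hFm : ∀ π ∈ S, AEStronglyMeasurable
      (fun p : E × E => g (a p.1, a p.2) - h (b p.1, b p.2))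
      ((π : Measure E).prod (π : Measure E)) := by
    intro π hπ
    have mpa : MeasurePreserving a (π : Measure E) ξ := ⟨ha.measurable, hSa π hπ⟩
    have mpb : MeasurePreserving b (π : Measure E) υ := ⟨hb.measurable, hSb π hπ⟩
    exact (hg.1.comp_measurePreserving (mpa.prod mpa)).sub
      (hh.1.comp_measurePreserving (mpb.prod mpb))
  have hFL : ∀ π ∈ S, L π = F π := by
    intro π hπ
    have hDm := fun q => (D q).continuous.aestronglyMeasurable
      (μ := (π : Measure E).prod (π : Measure E))
    refine le_antisymm (iSup_le fun q => tsub_le_iff_right.2 ?_)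
      (ENNReal.le_of_forall_pos_le_add fun ε hε _ => ?_)
    · have := eLpNorm_sub_le (p := 2) (hFm π hπ) ((hFm π hπ).sub (hDm q)) (by norm_num)
      rw [sub_sub_cancel] at this
      exact this.trans (add_le_add_right (hclose π hπ q) _)
    -- Two gauges are approximated, and the error `e` enters twice: in passing from `F` to the
    -- approximation and in the subtraction defining `L`. Hence a quarter of `ε` for each.
    · have hε4 : (ε : ℝ≥0∞) / 2 / 2 ≠ 0 := by simp [hε.ne']
      obtain ⟨g', hg', -⟩ := hg.exists_boundedContinuous_eLpNorm_sub_le (by norm_num) hε4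
      obtain ⟨h', hh', -⟩ := hh.exists_boundedContinuous_eLpNorm_sub_le (by norm_num) hε4
      have he : e (g', h') ≤ ε / 2 := by
        exact (add_le_add hg' hh').trans (ENNReal.add_halves _).le
      calc F π ≤ eLpNorm (D (g', h')) 2 ((π : Measure E).prod (π : Measure E)) + e (g', h') := by
            have := eLpNorm_add_le (p := 2) (hDm (g', h')) ((hFm π hπ).sub (hDm (g', h')))
              (by norm_num)
            rw [add_sub_cancel] at this
            exact this.trans (add_le_add_right (hclose π hπ _) _)
        _ ≤ (eLpNorm (D (g', h')) 2 ((π : Measure E).prod (π : Measure E)) - e (g', h'))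
            + e (g', h') + e (g', h') := by gcongr; exact le_tsub_add
        _ ≤ L π + ε := by
            rw [add_assoc]
            refine add_le_add (le_iSup (fun q => eLpNorm (D q) 2
              ((π : Measure E).prod (π : Measure E)) - e q) (g', h')) ?_
            exact (add_le_add he he).trans (ENNReal.add_halves _).le
  intro π hπ c hc
  have hc' : c < L π := by
    rw [hFL π hπ]
    exact hc
  filter_upwards [hL π hπ c hc', self_mem_nhdsWithin] with σ hσ hσS
  change c < F σ
  rw [← hFL σ hσS]
  exact hσ

/-! ### Gluing along a common marginal -/

/-- Gluing: finitely many plans with a common first marginal are the two-dimensional marginals of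
a single plan, obtained from the product of their conditional kernels. -/
lemma exists_measure_map_prodMk_eq {ι B : Type*} [Fintype ι] [MeasurableSpace B] {A : ι → Type*}
    [∀ i, MeasurableSpace (A i)] [∀ i, StandardBorelSpace (A i)] [∀ i, Nonempty (A i)]
    (υ : Measure B) [IsProbabilityMeasure υ] (π : ∀ i, Measure (B × A i))
    [∀ i, IsProbabilityMeasure (π i)] (hπ : ∀ i, (π i).map Prod.fst = υ) :
    ∃ γ : Measure (B × ∀ i, A i), IsProbabilityMeasure γ ∧ γ.map Prod.fst = υ ∧
      ∀ i, γ.map (fun p => (p.1, p.2 i)) = π i := by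
  let κ : Kernel B (∀ i, A i) :=
    { toFun := fun y => Measure.pi fun i => (π i).condKernel y
      measurable' := by
        -- Measurability need only be checked on boxes, where the product kernel is a finite product
        -- of measurable functions.
        refine Measurable.measure_of_isPiSystem_of_isProbabilityMeasure generateFrom_pi.symm
          isPiSystem_pi ?_
        rintro _ ⟨s, hs, rfl⟩
        simp only [Measure.pi_pi]
        exact Finset.measurable_prod _ fun i _ =>
          Kernel.measurable_coe _ (hs i (mem_univ i)) }
  have hκ : ∀ y, κ y = Measure.pi fun i => (π i).condKernel y := fun _ => rfl
  have : IsMarkovKernel κ := ⟨fun y => by rw [hκ]; infer_instance⟩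
  refine ⟨υ ⊗ₘ κ, inferInstance, Measure.fst_compProd _ _, fun i => ?_⟩
  have hd : (π i).fst ⊗ₘ (π i).condKernel = π i := (π i).disintegrate _
  have hfst : (π i).fst = υ := hπ i
  rw [hfst] at hd
  refine Eq.trans ?_ hd
  have hm : Measurable (fun p : B × ∀ i, A i => (p.1, p.2 i)) := by fun_prop
  ext s hs
  rw [Measure.map_apply hm hs, Measure.compProd_apply (hm hs), Measure.compProd_apply hs]
  refine lintegral_congr fun y => ?_
  rw [hκ, ← (measurePreserving_eval (fun i => (π i).condKernel y) i).map_eq,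
    Measure.map_apply (measurable_pi_apply i) (measurable_prodMk_left hs)]
  rfl

/-! ### Variance decomposition -/

/-- The variance decomposition: the weighted mean square distance of `G i` to `H` is the weighted
mean square distance of the `G i` to each other plus the square distance of `H` to the mean. -/
lemma sum_mul_sq_sub_eq {ι : Type*} [Fintype ι] {ρ : ι → ℝ} (hρ : ∑ i, ρ i = 1) (G : ι → ℝ)
    (H : ℝ) :
    ∑ i, ρ i * (H - G i) ^ 2 =
      (1 / 2) * ∑ i, ∑ j, ρ i * ρ j * |G i - G j| ^ 2 + (H - ∑ i, ρ i * G i) ^ 2 := by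
  have h1 : ∑ i, ρ i * (H - G i) ^ 2 =
      H ^ 2 - 2 * H * ∑ i, ρ i * G i + ∑ i, ρ i * G i ^ 2 := by
    calc ∑ i, ρ i * (H - G i) ^ 2
        = ∑ i, (ρ i * H ^ 2 - 2 * H * (ρ i * G i) + ρ i * G i ^ 2) :=
          Finset.sum_congr rfl fun i _ => by ring
      _ = _ := by
          rw [Finset.sum_add_distrib, Finset.sum_sub_distrib, ← Finset.sum_mul, hρ, one_mul,
            ← Finset.mul_sum]
  have h2 : ∑ i, ∑ j, ρ i * ρ j * |G i - G j| ^ 2 =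
      2 * ∑ i, ρ i * G i ^ 2 - 2 * (∑ i, ρ i * G i) ^ 2 := by
    calc ∑ i, ∑ j, ρ i * ρ j * |G i - G j| ^ 2
        = ∑ i, ∑ j, (ρ i * G i ^ 2 * ρ j - 2 * (ρ i * G i * (ρ j * G j))
            + ρ i * (ρ j * G j ^ 2)) :=
          Finset.sum_congr rfl fun i _ => Finset.sum_congr rfl fun j _ => by rw [sq_abs]; ring
      _ = _ := by
          simp only [Finset.sum_add_distrib, Finset.sum_sub_distrib, ← Finset.mul_sum,
            ← Finset.sum_mul, hρ]
          ring
  rw [h1, h2]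
  ring

/-- The variance decomposition for functions in `L²`. -/
lemma sum_mul_eLpNorm_sq_sub_eq {ι Ω : Type*} [Fintype ι] [MeasurableSpace Ω] {μ : Measure Ω}
    {ρ : ι → ℝ} (hρ : ρ ∈ stdSimplex ℝ ι) {G : ι → Ω → ℝ} {H : Ω → ℝ}
    (hG : ∀ i, AEStronglyMeasurable (G i) μ) (hH : AEStronglyMeasurable H μ) :
    ∑ i, ENNReal.ofReal (ρ i) * eLpNorm (fun p => H p - G i p) 2 μ ^ 2 =
      ∫⁻ p, ENNReal.ofReal ((1 / 2) * ∑ i, ∑ j, ρ i * ρ j * |G i p - G j p| ^ 2) ∂μ +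
        eLpNorm (fun p => H p - ∑ i, ρ i * G i p) 2 μ ^ 2 := by
  have hmG : ∀ i, AEMeasurable (G i) μ := fun i => (hG i).aemeasurable
  have hmH := hH.aemeasurable
  have hnn : ∀ p, 0 ≤ (1 / 2) * ∑ i, ∑ j, ρ i * ρ j * |G i p - G j p| ^ 2 := fun p =>
    mul_nonneg (by norm_num) (Finset.sum_nonneg fun i _ => Finset.sum_nonneg fun j _ =>
      mul_nonneg (mul_nonneg (hρ.1 i) (hρ.1 j)) (sq_nonneg _))
  have hm : ∀ i, AEMeasurable (fun p => ENNReal.ofReal ((H p - G i p) ^ 2)) μ := fun i => by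
    fun_prop
  have hi : ∀ i, ENNReal.ofReal (ρ i) * eLpNorm (fun p => H p - G i p) 2 μ ^ 2 =
      ∫⁻ p, ENNReal.ofReal (ρ i) * ENNReal.ofReal ((H p - G i p) ^ 2) ∂μ := fun i => by
    rw [eLpNorm_two_sq, lintegral_const_mul'' _ (hm i)]
  rw [eLpNorm_two_sq, ← lintegral_add_right' _ (by fun_prop), Finset.sum_congr rfl fun i _ => hi i,
    ← lintegral_finsetSum' _ fun i _ => (hm i).const_mul _]
  refine lintegral_congr fun p => ?_
  rw [← ENNReal.ofReal_add (hnn p) (sq_nonneg _), ← sum_mul_sq_sub_eq hρ.2,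
    ENNReal.ofReal_sum_of_nonneg fun i _ => mul_nonneg (hρ.1 i) (sq_nonneg _)]
  exact Finset.sum_congr rfl fun i _ => (ENNReal.ofReal_mul (hρ.1 i)).symm

end MeasureTheoryLemmas

/-! ### Existence of optimal pairwise plans -/

namespace GMSpace

/-- The GW distance is bounded by the cost of any coupling, given on an arbitrary probability
space. -/
lemma gw_le_of_measurePreserving (X Y : GMSpace.{u}) {Ω : Type*} [MeasurableSpace Ω]
    {μ : Measure Ω} [IsProbabilityMeasure μ] {a : Ω → X.carrier} {b : Ω → Y.carrier}
    (ha : MeasurePreserving a μ X.measure) (hb : MeasurePreserving b μ Y.measure) :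
    gw X Y ≤ eLpNorm (fun p : Ω × Ω => X.gauge (a p.1, a p.2) - Y.gauge (b p.1, b p.2)) 2
      (μ.prod μ) := by
  have hm : Measurable fun ω => (a ω, b ω) := ha.measurable.prodMk hb.measurable
  let π : ProbabilityMeasure (X.carrier × Y.carrier) :=
    ⟨μ.map fun ω => (a ω, b ω), Measure.isProbabilityMeasure_map hm.aemeasurable⟩
  have hmp : MeasurePreserving (fun ω => (a ω, b ω)) μ (π : Measure (X.carrier × Y.carrier)) :=
    ⟨hm, rfl⟩
  have hπ : π ∈ plans X Y := by
    constructor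
    · rw [← hmp.map_eq, Measure.map_map measurable_fst hm]
      exact ha.map_eq
    · rw [← hmp.map_eq, Measure.map_map measurable_snd hm]
      exact hb.map_eq
  refine (iInf₂_le π hπ).trans (le_of_eq ?_)
  rw [gwFunctional, ← eLpNorm_comp_measurePreserving (gaugeDiff_aestronglyMeasurable X Y hπ)
    (hmp.prod hmp)]
  rfl

lemma plans_nonempty (X Y : GMSpace.{u}) : (plans X Y).Nonempty :=
  ⟨⟨X.measure.prod Y.measure, inferInstance⟩, Measure.fst_prod, Measure.snd_prod⟩

/-- Prokhorov's theorem: fixed marginals force tightness, and the marginal constraints are closed.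
-/
lemma isCompact_plans (X Y : GMSpace.{u}) : IsCompact (plans X Y) := by
  have hclosed : IsClosed (plans X Y) :=
    (isClosed_setOf_map_eq continuous_fst X.measure).inter
      (isClosed_setOf_map_eq continuous_snd Y.measure)
  rw [← hclosed.closure_eq]
  refine isCompact_closure_of_isTightMeasureSet (IsTightMeasureSet.prodMk
    (isTightMeasureSet_of_subset_singleton (μ := X.measure) ?_)
    (isTightMeasureSet_of_subset_singleton (μ := Y.measure) ?_))
  · rintro _ ⟨_, ⟨π, hπ, rfl⟩, rfl⟩
    exact hπ.1
  · rintro _ ⟨_, ⟨π, hπ, rfl⟩, rfl⟩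
    exact hπ.2

/-- Optimal GW plans exist. -/
lemma exists_gwFunctional_eq_gw (X Y : GMSpace.{u}) :
    ∃ π ∈ plans X Y, gwFunctional X Y π = gw X Y := by
  have hlsc : LowerSemicontinuousOn (gwFunctional X Y) (plans X Y) :=
    lowerSemicontinuousOn_eLpNorm_sub continuous_fst continuous_snd X.gauge_memLp Y.gauge_memLp
      (fun _ hπ => hπ.1) (fun _ hπ => hπ.2)
  obtain ⟨π, hπ, hmin⟩ := hlsc.exists_isMinOn (plans_nonempty X Y) (isCompact_plans X Y)
  exact ⟨π, hπ, le_antisymm (le_iInf₂ fun σ hσ => hmin hσ) (iInf₂_le π hπ)⟩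

/-! ### Existence of optimal multi-marginal plans -/

variable {N : ℕ}

lemma measurePreserving_eval_of_mem_multiPlans {X : Fin N → GMSpace.{u}}
    {π : ProbabilityMeasure (∀ i, (X i).carrier)} (hπ : π ∈ multiPlans X) (i : Fin N) :
    MeasurePreserving (fun x : ∀ i, (X i).carrier => x i) (π : Measure (∀ i, (X i).carrier))
      (X i).measure :=
  ⟨measurable_pi_apply i, hπ i⟩

/-- The pullback of the `i`-th gauge to the product of the domains is square-integrable. -/
lemma memLp_gauge_eval {X : Fin N → GMSpace.{u}} {π : ProbabilityMeasure (∀ i, (X i).carrier)}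
    (hπ : π ∈ multiPlans X) (i : Fin N) :
    MemLp (fun p : (∀ i, (X i).carrier) × (∀ i, (X i).carrier) =>
      (X i).gauge (p.1 i, p.2 i)) 2
      ((π : Measure (∀ i, (X i).carrier)).prod (π : Measure (∀ i, (X i).carrier))) :=
  (X i).gauge_memLp.comp_measurePreserving ((measurePreserving_eval_of_mem_multiPlans hπ i).prod
    (measurePreserving_eval_of_mem_multiPlans hπ i))

lemma multiPlans_nonempty (X : Fin N → GMSpace.{u}) : (multiPlans X).Nonempty :=
  ⟨⟨Measure.pi fun i => (X i).measure, inferInstance⟩, fun i =>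
    (measurePreserving_eval (fun i => (X i).measure) i).map_eq⟩

lemma isCompact_multiPlans (X : Fin N → GMSpace.{u}) : IsCompact (multiPlans X) := by
  have hclosed : IsClosed (multiPlans X) := by
    have h : multiPlans X = ⋂ i, {π : ProbabilityMeasure (∀ i, (X i).carrier) |
        (π : Measure (∀ i, (X i).carrier)).map (fun x => x i) = (X i).measure} := by
      ext π
      simp [multiPlans]
    rw [h]
    exact isClosed_iInter fun i => isClosed_setOf_map_eq
      (f := fun x : ∀ i, (X i).carrier => x i) (continuous_apply i) (X i).measure
  rw [← hclosed.closure_eq]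
  refine isCompact_closure_of_isTightMeasureSet (isTightMeasureSet_pi fun i =>
    isTightMeasureSet_of_subset_singleton (μ := (X i).measure) ?_)
  rintro _ ⟨_, ⟨π, hπ, rfl⟩, rfl⟩
  exact hπ i

/-- The multi-marginal functional is a weighted sum of squared pairwise costs. -/
lemma mgwFunctional_eq_sum {ρ : Fin N → ℝ} (hρ : ∀ i, 0 ≤ ρ i) {X : Fin N → GMSpace.{u}}
    {π : ProbabilityMeasure (∀ i, (X i).carrier)} (hπ : π ∈ multiPlans X) :
    mgwFunctional ρ X π = ∑ i, ∑ j, ENNReal.ofReal (1 / 2 * (ρ i * ρ j)) *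
      eLpNorm (fun p : (∀ i, (X i).carrier) × (∀ i, (X i).carrier) =>
        (X i).gauge (p.1 i, p.2 i) - (X j).gauge (p.1 j, p.2 j)) 2
        ((π : Measure (∀ i, (X i).carrier)).prod (π : Measure (∀ i, (X i).carrier))) ^ 2 := by
  have hm : ∀ i j, AEMeasurable (fun p : (∀ i, (X i).carrier) × (∀ i, (X i).carrier) =>
      ENNReal.ofReal (((X i).gauge (p.1 i, p.2 i) - (X j).gauge (p.1 j, p.2 j)) ^ 2))
      ((π : Measure (∀ i, (X i).carrier)).prod (π : Measure (∀ i, (X i).carrier))) := fun i j =>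
    (((memLp_gauge_eval hπ i).1.aemeasurable.sub
      (memLp_gauge_eval hπ j).1.aemeasurable).pow_const 2).ennreal_ofReal
  have hw : ∀ i j, 0 ≤ 1 / 2 * (ρ i * ρ j) := fun i j =>
    mul_nonneg (by norm_num) (mul_nonneg (hρ i) (hρ j))
  simp_rw [eLpNorm_two_sq, ← lintegral_const_mul'' _ (hm _ _)]
  simp_rw [← lintegral_finsetSum' _ fun j _ => (hm _ j).const_mul _]
  rw [← lintegral_finsetSum' _ fun i _ =>
    Finset.aemeasurable_fun_sum _ fun j _ => (hm i j).const_mul _]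
  refine lintegral_congr fun p => ?_
  simp_rw [← ENNReal.ofReal_mul (hw _ _)]
  simp_rw [← ENNReal.ofReal_sum_of_nonneg fun j _ => mul_nonneg (hw _ j) (sq_nonneg _)]
  rw [← ENNReal.ofReal_sum_of_nonneg fun i _ =>
    Finset.sum_nonneg fun j _ => mul_nonneg (hw i j) (sq_nonneg _)]
  simp_rw [Finset.mul_sum, sq_abs, ← mul_assoc]

/-- Finiteness is what allows the cost of a plan to be cancelled in `ℝ≥0∞` when characterizing the
minimizers. -/
lemma mgwFunctional_lt_top {ρ : Fin N → ℝ} (hρ : ∀ i, 0 ≤ ρ i) {X : Fin N → GMSpace.{u}}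
    {π : ProbabilityMeasure (∀ i, (X i).carrier)} (hπ : π ∈ multiPlans X) :
    mgwFunctional ρ X π < ∞ := by
  rw [mgwFunctional_eq_sum hρ hπ]
  refine ENNReal.sum_lt_top.2 fun i _ => ENNReal.sum_lt_top.2 fun j _ =>
    ENNReal.mul_lt_top ENNReal.ofReal_lt_top (ENNReal.pow_lt_top ?_)
  exact ((memLp_gauge_eval hπ i).sub (memLp_gauge_eval hπ j)).2

/-- Optimal multi-marginal plans exist. -/
lemma optimalMultiPlans_nonempty {ρ : Fin N → ℝ} (hρ : ∀ i, 0 ≤ ρ i) (X : Fin N → GMSpace.{u}) :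
    (optimalMultiPlans ρ X).Nonempty := by
  have hlsc : LowerSemicontinuousOn (mgwFunctional ρ X) (multiPlans X) := by
    have h : LowerSemicontinuousOn
        (fun π : ProbabilityMeasure (∀ i, (X i).carrier) =>
          ∑ i, ∑ j, ENNReal.ofReal (1 / 2 * (ρ i * ρ j)) *
            eLpNorm (fun p : (∀ i, (X i).carrier) × (∀ i, (X i).carrier) =>
              (X i).gauge (p.1 i, p.2 i) - (X j).gauge (p.1 j, p.2 j)) 2
              ((π : Measure (∀ i, (X i).carrier)).prod (π : Measure (∀ i, (X i).carrier))) ^ 2)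
        (multiPlans X) := by
      refine lowerSemicontinuousOn_sum fun i _ => lowerSemicontinuousOn_sum fun j _ => ?_
      have hc : Continuous fun t : ℝ≥0∞ => ENNReal.ofReal (1 / 2 * (ρ i * ρ j)) * t ^ 2 :=
        (ENNReal.continuous_const_mul ENNReal.ofReal_ne_top).comp (ENNReal.continuous_pow 2)
      have hmono : Monotone fun t : ℝ≥0∞ => ENNReal.ofReal (1 / 2 * (ρ i * ρ j)) * t ^ 2 :=
        fun s t hst => by dsimp only; gcongr
      exact hc.comp_lowerSemicontinuousOn (lowerSemicontinuousOn_eLpNorm_sub (continuous_apply i)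
        (continuous_apply j) (X i).gauge_memLp (X j).gauge_memLp (fun _ hπ => hπ i)
        (fun _ hπ => hπ j)) hmono
    -- The expansion into pairwise costs holds only on `multiPlans X`, so semicontinuity is
    -- transferred within that set.
    intro π hπ c hc
    rw [mgwFunctional_eq_sum hρ hπ] at hc
    filter_upwards [h π hπ c hc, self_mem_nhdsWithin] with σ hσ hσS
    rw [mgwFunctional_eq_sum hρ hσS]
    exact hσ
  obtain ⟨π, hπ, hmin⟩ := hlsc.exists_isMinOn (multiPlans_nonempty X) (isCompact_multiPlans X)
  exact ⟨π, hπ, le_antisymm (le_iInf₂ fun σ hσ => hmin hσ) (iInf₂_le π hπ)⟩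

/-! ### Comparing the barycenter loss with the multi-marginal cost -/

/-- The loss of the weighted product along a multi-marginal plan is at most the multi-marginal
cost of the plan. -/
lemma barycenterLoss_weightedProduct_le {ρ : Fin N → ℝ} (hρ : ρ ∈ stdSimplex ℝ (Fin N))
    {X : Fin N → GMSpace.{u}} {π : ProbabilityMeasure (∀ i, (X i).carrier)}
    (hπ : π ∈ multiPlans X) :
    GM.barycenterLoss ρ (fun i => GM.mk (X i)) (GM.mk (weightedProduct ρ X π hπ)) ≤
      mgwFunctional ρ X π := by
  have hid : MeasurePreserving (fun x => x) (π : Measure (∀ i, (X i).carrier))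
      (weightedProduct ρ X π hπ).measure := MeasurePreserving.id _
  have hmean : AEStronglyMeasurable (fun p : (∀ i, (X i).carrier) × (∀ i, (X i).carrier) =>
      ∑ i, ρ i * (X i).gauge (p.1 i, p.2 i))
      ((π : Measure (∀ i, (X i).carrier)).prod (π : Measure (∀ i, (X i).carrier))) :=
    (weightedProduct ρ X π hπ).gauge_memLp.1
  -- With `H` equal to the mean gauge the remainder in the variance identity is zero.
  have hvar := sum_mul_eLpNorm_sq_sub_eq hρ (fun i => (memLp_gauge_eval hπ i).1) hmean
  simp only [sub_self, eLpNorm_zero', ne_eq, OfNat.ofNat_ne_zero, not_false_eq_true, zero_pow,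
    add_zero] at hvar
  refine (Finset.sum_le_sum fun i _ => ?_).trans hvar.le
  refine mul_le_mul' le_rfl (pow_le_pow_left' ?_ 2)
  have h := gw_le_of_measurePreserving (weightedProduct ρ X π hπ) (X i)
    (Ω := ∀ i, (X i).carrier) (a := fun x => x) (b := fun x => x i) hid
    (measurePreserving_eval_of_mem_multiPlans hπ i)
  exact (gw_comm (X i) (weightedProduct ρ X π hπ)).le.trans h

/-- Gluing optimal plans between `Y` and the `X i` along `Y` gives a multi-marginal plan whose
cost is at most the loss of `Y`, up to the squared distance of `Y` to its weighted product. -/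
lemma exists_mgwFunctional_add_gw_sq_le {ρ : Fin N → ℝ} (hρ : ρ ∈ stdSimplex ℝ (Fin N))
    (X : Fin N → GMSpace.{u}) (Y : GMSpace.{u}) :
    ∃ (π : ProbabilityMeasure (∀ i, (X i).carrier)) (hπ : π ∈ multiPlans X),
      mgwFunctional ρ X π + gw Y (weightedProduct ρ X π hπ) ^ 2 ≤
        GM.barycenterLoss ρ (fun i => GM.mk (X i)) (GM.mk Y) := by
  -- Exactly optimal plans make the loss of `Y` equal to an integral over `γ ⊗ γ`, with no error
  -- term.
  choose σ hσ hopt using fun i => exists_gwFunctional_eq_gw Y (X i)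
  obtain ⟨γ, hγ, hfst, hglue⟩ := exists_measure_map_prodMk_eq Y.measure
    (fun i => (σ i : Measure (Y.carrier × (X i).carrier))) (fun i => (hσ i).1)
  have hb : MeasurePreserving Prod.fst γ Y.measure := ⟨measurable_fst, hfst⟩
  have hpair : ∀ i, MeasurePreserving (fun p : Y.carrier × ∀ i, (X i).carrier => (p.1, p.2 i)) γ
      (σ i : Measure (Y.carrier × (X i).carrier)) := fun i => ⟨by fun_prop, hglue i⟩
  have hsnd : ∀ i, MeasurePreserving (Prod.snd : Y.carrier × (X i).carrier → _)
      (σ i : Measure (Y.carrier × (X i).carrier)) (X i).measure :=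
    fun i => ⟨measurable_snd, (hσ i).2⟩
  have ha : ∀ i, MeasurePreserving (fun p : Y.carrier × ∀ i, (X i).carrier => p.2 i) γ
      (X i).measure := fun i => (hsnd i).comp (hpair i)
  let π : ProbabilityMeasure (∀ i, (X i).carrier) :=
    ⟨γ.map Prod.snd, Measure.isProbabilityMeasure_map measurable_snd.aemeasurable⟩
  have hmp : MeasurePreserving Prod.snd γ (π : Measure (∀ i, (X i).carrier)) :=
    ⟨measurable_snd, rfl⟩
  have hπ : π ∈ multiPlans X := fun i => by
    rw [← hmp.map_eq, Measure.map_map (measurable_pi_apply i) measurable_snd]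
    exact (ha i).map_eq
  refine ⟨π, hπ, ?_⟩
  -- Here `H` is the gauge of `Y`. The remainder is the squared cost of `γ` as a coupling of `Y`
  -- with the weighted product, so it dominates the squared GW distance.
  have hvar := sum_mul_eLpNorm_sq_sub_eq hρ
    (fun i => (X i).gauge_memLp.1.comp_measurePreserving ((ha i).prod (ha i)))
    (Y.gauge_memLp.1.comp_measurePreserving (hb.prod hb))
  have hloss : GM.barycenterLoss ρ (fun i => GM.mk (X i)) (GM.mk Y) =
      ∑ i, ENNReal.ofReal (ρ i) * eLpNorm (fun p : (Y.carrier × ∀ i, (X i).carrier) ×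
        (Y.carrier × ∀ i, (X i).carrier) => Y.gauge (p.1.1, p.2.1) -
          (X i).gauge (p.1.2 i, p.2.2 i)) 2 (γ.prod γ) ^ 2 := by
    refine Finset.sum_congr rfl fun i _ => ?_
    change _ * gw (X i) Y ^ 2 = _
    rw [gw_comm, ← hopt i, gwFunctional, ← eLpNorm_comp_measurePreserving
      (gaugeDiff_aestronglyMeasurable Y (X i) (hσ i)) ((hpair i).prod (hpair i))]
    rfl
  rw [hloss]
  refine le_trans (add_le_add (le_of_eq ?_) ?_) hvar.ge
  · have hmG : ∀ i, AEMeasurable (fun p : (∀ i, (X i).carrier) × (∀ i, (X i).carrier) =>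
        (X i).gauge (p.1 i, p.2 i))
        ((π : Measure (∀ i, (X i).carrier)).prod (π : Measure (∀ i, (X i).carrier))) :=
      fun i => (memLp_gauge_eval hπ i).1.aemeasurable
    rw [mgwFunctional]
    -- Writing `π ⊗ π` as the image of `γ ⊗ γ` allows a change of variables.
    simp_rw [← (hmp.prod hmp).map_eq] at hmG ⊢
    rw [lintegral_map' (by simp_rw [sq_abs]; fun_prop) (hmp.prod hmp).measurable.aemeasurable]
    rfl
  · exact pow_le_pow_left'
      (gw_le_of_measurePreserving Y (weightedProduct ρ X π hπ) hb hmp) 2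

end GMSpace

/-! ### Existence and characterization of barycenters -/

theorem theorem5p1 {N : ℕ} (X : Fin N → GMSpace.{u}) (ρ : Fin N → ℝ)
    (hρ : ρ ∈ stdSimplex ℝ (Fin N)) :
    (∃ 𝔜 : GM.{u}, 𝔜 ∈ GM.barycenters ρ (fun i => GM.mk (X i))) ∧
    GM.barycenters ρ (fun i => GM.mk (X i)) =
      {𝔜 : GM.{u} | ∃ (π : ProbabilityMeasure (∀ i, (X i).carrier))
        (hπ : π ∈ GMSpace.optimalMultiPlans ρ X),
        𝔜 = GM.mk (GMSpace.weightedProduct ρ X π hπ.1)} := by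
  have hlower : GMSpace.mgw ρ X ≤ GM.gwb ρ (fun i => GM.mk (X i)) := by
    refine le_iInf fun 𝔜 => ?_
    induction 𝔜 using Quotient.inductionOn with
    | h Y =>
      obtain ⟨π, hπ, hle⟩ := GMSpace.exists_mgwFunctional_add_gw_sq_le hρ X Y
      exact (iInf₂_le π hπ).trans (le_self_add.trans hle)
  have hmem : ∀ π (hπ : π ∈ GMSpace.optimalMultiPlans ρ X),
      GM.mk (GMSpace.weightedProduct ρ X π hπ.1) ∈ GM.barycenters ρ (fun i => GM.mk (X i)) :=
    fun π hπ => le_antisymm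
      ((GMSpace.barycenterLoss_weightedProduct_le hρ hπ.1).trans (hπ.2.le.trans hlower))
      (iInf_le _ _)
  obtain ⟨π₀, hπ₀⟩ := GMSpace.optimalMultiPlans_nonempty hρ.1 X
  refine ⟨⟨_, hmem π₀ hπ₀⟩, Subset.antisymm (fun 𝔜 h𝔜 => ?_) ?_⟩
  · have hupper : GM.gwb ρ (fun i => GM.mk (X i)) ≤ GMSpace.mgw ρ X :=
      (iInf_le _ _).trans ((GMSpace.barycenterLoss_weightedProduct_le hρ hπ₀.1).trans hπ₀.2.le)
    induction 𝔜 using Quotient.inductionOn with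
    | h Y =>
      obtain ⟨π, hπ, hle⟩ := GMSpace.exists_mgwFunctional_add_gw_sq_le hρ X Y
      -- The loss of the minimizer `Y` is at most `mgw`, while the cost of `π` is at least `mgw`:
      -- the cost must be optimal and, being finite, leaves no room for the squared distance.
      have hle' : GMSpace.mgwFunctional ρ X π +
          GMSpace.gw Y (GMSpace.weightedProduct ρ X π hπ) ^ 2 ≤ GMSpace.mgw ρ X :=
        hle.trans ((show GM.barycenterLoss ρ (fun i => GM.mk (X i)) (GM.mk Y) = _ from h𝔜).le.trans
          hupper)
      have hopt : GMSpace.mgwFunctional ρ X π = GMSpace.mgw ρ X :=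
        le_antisymm (le_self_add.trans hle') (iInf₂_le π hπ)
      have hzero : GMSpace.gw Y (GMSpace.weightedProduct ρ X π hπ) ^ 2 = 0 := by
        rw [← hopt] at hle'
        have h := ENNReal.le_sub_of_add_le_left
          (GMSpace.mgwFunctional_lt_top hρ.1 hπ).ne hle'
        rwa [tsub_self, nonpos_iff_eq_zero] at h
      exact ⟨π, ⟨hπ, hopt⟩, Quotient.sound (pow_eq_zero_iff two_ne_zero |>.1 hzero)⟩
  · rintro _ ⟨π, hπ, rfl⟩
    exact hmem π hπ
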